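/- Let $F/\mathbf{F}_q$ be an algebraic function field of one variable over a finite field $\mathbf{F}_q$, let $Q, P_1,\dots,P_n$ be $n+1$ distinct places of degree one of $F$, and let $v_P$ denote the normalized discrete valuation at a place $P$. Put $D=P_1+\cdots+P_n$. For a divisor $G$ let $\mathcal{L}(-G+\infty Q)=\bigcup_{i\ge 1}\mathcal{L}(-G+iQ)$, and let $\mathcal{L}(\infty Q)=\bigcup_{i\ge 1}\mathcal{L}(iQ)$. Let $a_1\ge 1$ be an integer and let $x_1\in F$ have pole divisor $(x_1)_\infty=a_1Q$. Let $\vec r=(r_1,\dots,r_n)\in\mathbf{F}_q^n$ and let $h_{\vec r}\in\mathcal{L}(\infty Q)$ satisfy $h_{\vec r}(P_k)=r_k$ for all $k$. Let $0\le m\le \ell$ be integers. For $0\le i\le m$ and $0\le j<a_1$ let $\eta_{i,j}$ be a nonzero element of $\mathcal{L}(-iD+\infty Q)$ with $-v_Q(\eta_{i,j})\equiv j \pmod{a_1}$ such that $-v_Q(\eta_{i,j})$ is minimal among the pole orders $-v_Q(\eta)$ of the nonzero $\eta\in\mathcal{L}(-iD+\infty Q)$ with $-v_Q(\eta)\equiv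 j\pmod{a_1}$. A polynomial $p(Z)\in\mathcal{L}(\infty Q)[Z]$ is said to have multiplicity $m$ at $(P_k,r_k)$ if, writing $p(Z+r_k)=\sum_t c_tZ^t$, one has $v_{P_k}(c_t)\ge m-t$ for every $t\ge 0$ (where $v_{P_k}(0)=\infty$). Let $I_{\vec r,m,\ell}$ be the set of all $p(Z)\in\mathcal{L}(\infty Q)[Z]$ with $\deg_Z p\le\ell$ that have multiplicity $m$ at $(P_k,r_k)$ for every $k=1,\dots,n$. Then $I_{\vec r,m,\ell}$ is the $\mathbf{F}_q[x_1]$-submodule of $\mathcal{L}(\infty Q)[Z]$ generated by $$\{(Z-h_{\vec r})^{m-i}\eta_{i,j}\mid 0\le i\le m,\ 0\le j<a_1\}\ \cup\ \{Z^{\ell'-m}(Z-h_{\vec r})^m\eta_{0,j}\mid m<\ell'\le\ell,\ 0\le j<a_1\}.$$ -/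

import Mathlib

open Polynomial

/-- `F` is an algebraic function field of one variable over `K`: it is a finite extension of
`K(x)` for some `x ∈ F` that is transcendental over `K`. -/
def IsAlgebraicFunctionField (K F : Type*) [Field K] [Field F] [Algebra K F] : Prop :=
  ∃ x : F, Transcendental K x ∧ FiniteDimensional (IntermediateField.adjoin K {x}) F

/-- A place of `F / K`, given by its normalized discrete valuation `F → ℤ ∪ {∞}`, trivial
on `K`. The value group is written multiplicatively, as everywhere in Mathlib. -/
@[ext]
structure Place (K F : Type*) [Field K] [Field F] [Algebra K F] where
  val : Valuation F (WithZero (Multiplicative ℤ))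
  surjective : Function.Surjective val
  trivial_on : ∀ c : K, c ≠ 0 → val (algebraMap K F c) = 1

namespace Place

variable {K F : Type*} [Field K] [Field F] [Algebra K F]

theorem val_algebraMap_le_one (P : Place K F) (c : K) : P.val (algebraMap K F c) ≤ 1 := by
  by_cases hc : c = 0
  · simp [hc]
  · exact (P.trivial_on c hc).le

/-- The valuation ring `O_P` of the place `P`. -/
abbrev ring (P : Place K F) : ValuationSubring F := P.val.valuationSubring

noncomputable instance (P : Place K F) : Algebra K P.ring :=
  ((algebraMap K F).codRestrict P.ring.toSubring
    (fun c => P.val_algebraMap_le_one c)).toAlgebra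

/-- The degree of a place: the degree over `K` of its residue field. -/
noncomputable def deg (P : Place K F) : ℕ :=
  Module.finrank K (IsLocalRing.ResidueField P.ring)

/-- The additive valuation `v_P(f) ∈ ℤ` of `f ≠ 0` (with the irrelevant value `0` at `f = 0`). -/
noncomputable def ord (P : Place K F) (f : F) : ℤ := -WithZero.log (P.val f)

/-- `f(P) = c`, for `c ∈ K`: the function `f` is congruent to `c` modulo the maximal ideal
of `O_P`. -/
def HasValue (P : Place K F) (f : F) (c : K) : Prop := P.val (f - algebraMap K F c) < 1

theorem ord_mul (P : Place K F) {f g : F} (hf : f ≠ 0) (hg : g ≠ 0) :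
    P.ord (f * g) = P.ord f + P.ord g := by
  have h1 : P.val f ≠ 0 := (Valuation.ne_zero_iff _).2 hf
  have h2 : P.val g ≠ 0 := (Valuation.ne_zero_iff _).2 hg
  simp only [ord, map_mul, WithZero.log_mul h1 h2]
  ring

theorem min_ord_le_ord_add (P : Place K F) {f g : F} (hf : f ≠ 0) (hg : g ≠ 0)
    (hfg : f + g ≠ 0) : min (P.ord f) (P.ord g) ≤ P.ord (f + g) := by
  have h1 : P.val f ≠ 0 := (Valuation.ne_zero_iff _).2 hf
  have h2 : P.val g ≠ 0 := (Valuation.ne_zero_iff _).2 hg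
  have h3 : P.val (f + g) ≠ 0 := (Valuation.ne_zero_iff _).2 hfg
  have h := P.val.map_add f g
  simp only [ord]
  rcases le_max_iff.1 h with h | h
  · have := (WithZero.log_le_log h3 h1).2 h
    exact (min_le_left _ _).trans (neg_le_neg this)
  · have := (WithZero.log_le_log h3 h2).2 h
    exact (min_le_right _ _).trans (neg_le_neg this)

theorem ord_algebraMap (P : Place K F) (c : K) : P.ord (algebraMap K F c) = 0 := by
  by_cases hc : c = 0
  · simp [ord, hc]
  · simp [ord, P.trivial_on c hc]

end Place

/-- Divisors of `F / K`. -/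
abbrev FFDivisor (K F : Type*) [Field K] [Field F] [Algebra K F] := Place K F →₀ ℤ

section

variable {K F : Type*} [Field K] [Field F] [Algebra K F]

/-- The place `P` as a prime divisor. -/
noncomputable def Place.toDivisor (P : Place K F) : FFDivisor K F := Finsupp.single P 1

/-- The pole divisor `(f)_∞` of the nonzero function `f` is the divisor `A`. -/
def HasPoleDivisor (f : F) (A : FFDivisor K F) : Prop :=
  f ≠ 0 ∧ ∀ P : Place K F, max (-P.ord f) 0 = A P

/-- The Riemann-Roch space `L(A) = {f | (f) + A ≥ 0} ∪ {0}`. -/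
def riemannRochSpace (A : FFDivisor K F) : Set F :=
  {f | f = 0 ∨ ∀ P : Place K F, 0 ≤ P.ord f + A P}

/-- `L(A + ∞Q)`, the union of the spaces `L(A + iQ)` over `i ≥ 1`. -/
def spaceInfty (A : FFDivisor K F) (Q : Place K F) : Set F :=
  ⋃ i ∈ Set.Ici (1 : ℕ), riemannRochSpace (A + i • Q.toDivisor)

theorem toDivisor_nonneg (P Q : Place K F) : 0 ≤ Q.toDivisor P := by
  classical
  simp only [Place.toDivisor, Finsupp.single_apply]
  split_ifs <;> norm_num

theorem mem_spaceInfty_zero {Q : Place K F} {f : F} :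
    f ∈ spaceInfty 0 Q ↔
      ∃ i : ℕ, 1 ≤ i ∧ (f = 0 ∨ ∀ P : Place K F, 0 ≤ P.ord f + i * Q.toDivisor P) := by
  simp [spaceInfty, riemannRochSpace]

/-- The ring `L(∞Q)`. -/
def ringInfty (Q : Place K F) : Subalgebra K F where
  carrier := spaceInfty 0 Q
  mul_mem' := by
    intro f g hf hg
    rw [mem_spaceInfty_zero] at hf hg ⊢
    obtain ⟨i, hi, hf⟩ := hf
    obtain ⟨j, hj, hg⟩ := hg
    refine ⟨i + j, by omega, ?_⟩
    by_cases hf0 : f = 0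
    · exact Or.inl (by simp [hf0])
    by_cases hg0 : g = 0
    · exact Or.inl (by simp [hg0])
    right
    intro P
    have h1 := hf.resolve_left hf0 P
    have h2 := hg.resolve_left hg0 P
    rw [P.ord_mul hf0 hg0]
    push_cast
    linarith
  add_mem' := by
    intro f g hf hg
    by_cases hf0 : f = 0
    · simpa [hf0] using hg
    by_cases hg0 : g = 0
    · simpa [hg0] using hf
    rw [mem_spaceInfty_zero] at hf hg ⊢
    obtain ⟨i, hi, hf⟩ := hf
    obtain ⟨j, hj, hg⟩ := hg
    refine ⟨i + j, by omega, ?_⟩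
    by_cases hfg : f + g = 0
    · exact Or.inl hfg
    right
    intro P
    have h1 := hf.resolve_left hf0 P
    have h2 := hg.resolve_left hg0 P
    have h3 := P.min_ord_le_ord_add hf0 hg0 hfg
    have hQ := toDivisor_nonneg P Q
    have h4 : 0 ≤ (i : ℤ) * Q.toDivisor P := by positivity
    have h5 : 0 ≤ (j : ℤ) * Q.toDivisor P := by positivity
    push_cast
    rcases min_le_iff.1 h3 with h | h <;> linarith
  algebraMap_mem' := by
    intro c
    rw [mem_spaceInfty_zero]
    refine ⟨1, le_rfl, Or.inr fun P => ?_⟩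
    rw [P.ord_algebraMap]
    simpa using toDivisor_nonneg P Q

/-- The polynomial `p ∈ L(∞Q)[Z]` has multiplicity (at least) `m` at the point `(P, r)`:
after the translation `Z ↦ Z + r`, every monomial `c Z ^ t` of `p` satisfies
`v_P(c) + t ≥ m`. -/
def HasMultiplicity {Q : Place K F} (p : (ringInfty Q)[X]) (P : Place K F) (r : K) (m : ℕ) :
    Prop :=
  ∀ t : ℕ,
    let c : F := ((p.comp (X + C (algebraMap K (ringInfty Q) r))).coeff t : F)
    c = 0 ∨ (m : ℤ) ≤ P.ord c + t

/-- The set `I_{r,m,ℓ}` of all polynomials in `L(∞Q)[Z]` of `Z`-degree at most `ℓ` that have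
multiplicity `m` at all the points `(P_i, r_i)`. -/
def interpolationModule (Q : Place K F) {n : ℕ} (P : Fin n → Place K F) (r : Fin n → K)
    (m ℓ : ℕ) : Set (ringInfty Q)[X] :=
  {p | (∀ i, HasMultiplicity p (P i) (r i) m) ∧ p.degree ≤ ℓ}

/-- `g` is a (nonzero) element of `L(A + ∞Q)` whose pole order `-v_Q(g)` at `Q` is the minimum
among the pole orders of nonzero elements of `L(A + ∞Q)` that are congruent to `j` modulo `a`. -/
def IsMinimalPoleOrder (A : FFDivisor K F) (Q : Place K F) (a j : ℕ) (g : F) : Prop :=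
  (g ∈ spaceInfty A Q ∧ g ≠ 0 ∧ -Q.ord g ≡ j [ZMOD a]) ∧
    ∀ f : F, f ∈ spaceInfty A Q → f ≠ 0 → -Q.ord f ≡ j [ZMOD a] → -Q.ord g ≤ -Q.ord f

end

/-! ### Orders and leading coefficients at a place of degree one -/

section

variable {K F : Type*} [Field K] [Field F] [Algebra K F]

/-! Write p = ∑ c_t (Z - h)^t. Since h - r_k vanishes at P_k, translating by h instead of r_k does
not affect multiplicity (`hasMultiplicity_iff_comp_mem_weightSubmodule`). Hence p has multiplicity m
at all the points iff c_t vanishes to order m - t at every P_k for each t < m; for t ≥ m there is no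
condition, as L(∞Q) is regular at P_k. The part of degree at least m in Z - h is thus an arbitrary
multiple of (Z - h)^m of degree at most ℓ.

It remains to generate the ideals L(-iD + ∞Q) over K[x₁] (`mem_span_of_minimal_pole_order`).
Subtracting a suitable constant times x₁^d η_{i,j} cancels the leading pole term at Q, because Q has
degree one. This descent stops, because minimality of the η_{i,j} bounds pole orders from below. -/

/-- Degree one makes the residue field a line over `K` spanned by 1, so every residue is a constant.
-/
theorem Place.exists_val_sub_algebraMap_lt_one (Q : Place K F) (hQ : Q.deg = 1) {u : F}
    (hu : Q.val u ≤ 1) : ∃ c : K, Q.val (u - algebraMap K F c) < 1 := by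
  obtain ⟨c, hc⟩ := (finrank_eq_one_iff_of_nonzero' (K := K)
    (1 : IsLocalRing.ResidueField Q.ring) one_ne_zero).1 hQ
      (IsLocalRing.residue Q.ring ⟨u, hu⟩)
  refine ⟨c, ?_⟩
  have h1 : IsLocalRing.residue Q.ring (⟨u, hu⟩ - algebraMap K Q.ring c) = 0 := by
    rw [map_sub, ← hc, Algebra.smul_def, mul_one, sub_eq_zero]
    rfl
  rw [IsLocalRing.residue_eq_zero_iff] at h1
  exact (Valuation.mem_maximalIdeal_iff (v := Q.val)).1 h1

theorem Place.le_ord_iff (P : Place K F) {f : F} (hf : f ≠ 0) (k : ℤ) :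
    k ≤ P.ord f ↔ P.val f ≤ WithZero.exp (-k) := by
  rw [← WithZero.log_le_iff_le_exp ((Valuation.ne_zero_iff _).2 hf), Place.ord]
  omega

theorem Place.eq_zero_or_le_ord_iff (P : Place K F) (f : F) (k : ℤ) :
    (f = 0 ∨ k ≤ P.ord f) ↔ P.val f ≤ WithZero.exp (-k) := by
  by_cases hf : f = 0
  · simp [hf]
  · rw [← P.le_ord_iff hf]
    simp [hf]

theorem Place.ord_pow (P : Place K F) (f : F) (k : ℕ) : P.ord (f ^ k) = k * P.ord f := by
  simp [Place.ord, WithZero.log_pow]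

/-- A function `f` can be approximated at a place of degree one by constant multiples of any
function of the same order. -/
theorem Place.exists_ord_lt_ord_sub (Q : Place K F) (hQ : Q.deg = 1) {f g : F} (hf : f ≠ 0)
    (hg : g ≠ 0) (hfg : Q.ord f = Q.ord g) :
    ∃ c : K, f - algebraMap K F c * g = 0 ∨ Q.ord f < Q.ord (f - algebraMap K F c * g) := by
  have hf' : Q.val f ≠ 0 := (Valuation.ne_zero_iff _).2 hf
  have hg' : Q.val g ≠ 0 := (Valuation.ne_zero_iff _).2 hg
  have hval : Q.val f = Q.val g := by
    rw [← WithZero.exp_log hf', ← WithZero.exp_log hg']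
    simp only [Place.ord, neg_inj] at hfg
    rw [hfg]
  obtain ⟨c, hc⟩ := Q.exists_val_sub_algebraMap_lt_one hQ (u := f / g)
    (by rw [map_div₀, hval, div_self hg'])
  refine ⟨c, or_iff_not_imp_left.2 fun hne => ?_⟩
  have hlt : Q.val (f - algebraMap K F c * g) < Q.val f := by
    have : f - algebraMap K F c * g = (f / g - algebraMap K F c) * g := by
      field_simp
    rw [this, map_mul, hval]
    exact mul_lt_of_lt_one_left (zero_lt_iff.2 hg') hc
  have := (WithZero.log_lt_log ((Valuation.ne_zero_iff _).2 hne) hf').2 hlt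
  simp only [Place.ord]
  omega

theorem Place.val_le_one_of_mem_ringInfty {P Q : Place K F} (hPQ : P ≠ Q) (f : ringInfty Q) :
    P.val (f : F) ≤ 1 := by
  obtain ⟨i, -, hi⟩ := mem_spaceInfty_zero.1 f.2
  have := (P.eq_zero_or_le_ord_iff (f : F) 0).1 (hi.imp_right fun h => by
    have := h P
    rwa [Place.toDivisor, Finsupp.single_eq_of_ne hPQ, mul_zero, add_zero] at this)
  simpa using this

/-! ### Vanishing along D and generators over K[x] -/

theorem nsmul_sum_toDivisor_apply {n : ℕ} {P : Fin n → Place K F} (hP : Function.Injective P)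
    (i : ℕ) (k : Fin n) : (i • ∑ k, (P k).toDivisor) (P k) = i := by
  classical
  simp [Place.toDivisor, Finsupp.single_apply, hP.eq_iff]

theorem nsmul_sum_toDivisor_apply_of_ne {n : ℕ} {P : Fin n → Place K F} {R : Place K F}
    (hR : ∀ k, P k ≠ R) (i : ℕ) : (i • ∑ k, (P k).toDivisor) R = 0 := by
  classical
  simp [Place.toDivisor, hR]

theorem coe_mem_spaceInfty_neg_iff {Q : Place K F} {n : ℕ} {P : Fin n → Place K F}
    (hP : Function.Injective P) (hPQ : ∀ k, P k ≠ Q) (i : ℕ) (f : ringInfty Q) :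
    (f : F) ∈ spaceInfty (-(i • ∑ k, (P k).toDivisor)) Q ↔
      ∀ k, (P k).val (f : F) ≤ WithZero.exp (-(i : ℤ)) := by
  simp only [spaceInfty, riemannRochSpace, Set.mem_iUnion, Set.mem_Ici, Set.mem_ofPred_eq]
  constructor
  · rintro ⟨N, -, hN⟩ k
    refine ((P k).eq_zero_or_le_ord_iff _ _).1 (hN.imp_right fun hN => ?_)
    have := hN (P k)
    rw [Finsupp.add_apply, Finsupp.neg_apply, nsmul_sum_toDivisor_apply hP, Finsupp.smul_apply,
      Place.toDivisor, Finsupp.single_eq_of_ne (hPQ k), smul_zero] at this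
    omega
  · intro hf
    obtain ⟨N, hN1, hN⟩ := mem_spaceInfty_zero.1 f.2
    refine ⟨N, hN1, or_iff_not_imp_left.2 fun hf0 R => ?_⟩
    have hR := hN.resolve_left hf0 R
    rw [← nsmul_eq_mul, ← Finsupp.smul_apply] at hR
    rw [Finsupp.add_apply, Finsupp.neg_apply]
    by_cases h : ∃ k, P k = R
    · obtain ⟨k, rfl⟩ := h
      have h1 := ((P k).le_ord_iff hf0 _).2 (hf k)
      rw [nsmul_sum_toDivisor_apply hP, Finsupp.smul_apply, Place.toDivisor,
        Finsupp.single_eq_of_ne (hPQ k), smul_zero]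
      omega
    · rw [nsmul_sum_toDivisor_apply_of_ne (not_exists.1 h)]
      omega

/-- Elements of an ideal of `L(∞Q)` that have minimal pole orders at `Q` in their residue
classes modulo `a` generate the ideal over `K[x]`, if `x` has pole order `a`. -/
theorem mem_span_of_minimal_pole_order {Q : Place K F} (hQ : Q.deg = 1) {a : ℕ} (ha : 0 < a)
    {x : ringInfty Q} (hx : Q.ord (x : F) = -a) (V : Ideal (ringInfty Q))
    (η : ℕ → ringInfty Q) (hV : ∀ j < a, η j ∈ V) (h0 : ∀ j < a, (η j : F) ≠ 0)
    (hmod : ∀ j < a, -Q.ord (η j : F) ≡ j [ZMOD a])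
    (hmin : ∀ j < a, ∀ f ∈ V, (f : F) ≠ 0 → -Q.ord (f : F) ≡ j [ZMOD a] →
      -Q.ord (η j : F) ≤ -Q.ord (f : F))
    {f : ringInfty Q} (hf : f ∈ V) :
    f ∈ Submodule.span (Algebra.adjoin K {x}) (η '' Set.Iio a) := by
  have hclass (f : ringInfty Q) : ∃ j < a, -Q.ord (f : F) ≡ j [ZMOD a] := by
    have ha' : (0 : ℤ) < a := by exact_mod_cast ha
    have h1 := Int.emod_nonneg (-Q.ord (f : F)) ha'.ne'
    have h2 := Int.emod_lt_of_pos (-Q.ord (f : F)) ha'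
    refine ⟨(-Q.ord (f : F) % a).toNat, by omega, ?_⟩
    rw [Int.toNat_of_nonneg h1]
    exact (Int.mod_modEq _ _).symm
  -- Each nonzero element of `V` has order at most that of the `η j` in its class; the sum of
  -- absolute values dominates all of these. The descent is on `B - Q.ord f`.
  obtain ⟨B, hB⟩ : ∃ B : ℤ, ∀ f ∈ V, (f : F) ≠ 0 → Q.ord (f : F) ≤ B := by
    refine ⟨∑ j ∈ Finset.range a, |Q.ord (η j : F)|, fun f hf hf0 => ?_⟩
    obtain ⟨j, hj, hfj⟩ := hclass f
    have h1 := hmin j hj f hf hf0 hfj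
    have h2 := Finset.single_le_sum (f := fun j => |Q.ord (η j : F)|)
      (fun i _ => abs_nonneg _) (Finset.mem_range.2 hj)
    have h3 := le_abs_self (Q.ord (η j : F))
    omega
  induction hk : (B - Q.ord (f : F)).toNat using Nat.strong_induction_on generalizing f with
  | _ k ih =>
  by_cases hf0 : (f : F) = 0
  · rw [show f = 0 from Subtype.ext hf0]
    exact zero_mem _
  obtain ⟨j, hj, hfj⟩ := hclass f
  have hle := hmin j hj f hf hf0 hfj
  -- The pole orders of `f` and `η j` differ by `a * d`, and minimality gives `d ≥ 0`, so `x ^ d * η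
  -- j` matches the order of `f`.
  obtain ⟨d, hd⟩ := ((hmod j hj).trans hfj.symm).dvd
  have hd0 : 0 ≤ d := by
    by_contra hneg
    have : (a : ℤ) * d < 0 := mul_neg_of_pos_of_neg (by exact_mod_cast ha) (by omega)
    omega
  lift d to ℕ using hd0
  have hx0 : (x : F) ≠ 0 := by
    intro h
    -- By convention the order of 0 is 0, which contradicts `-a < 0`.
    simp only [h, Place.ord, map_zero, WithZero.log_zero] at hx
    omega
  set g : ringInfty Q := x ^ d * η j with hg
  have hg0 : (g : F) ≠ 0 := by
    rw [hg, MulMemClass.coe_mul, SubmonoidClass.coe_pow]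
    exact mul_ne_zero (pow_ne_zero _ hx0) (h0 j hj)
  have hgord : Q.ord (f : F) = Q.ord (g : F) := by
    simp only [hg, MulMemClass.coe_mul, SubmonoidClass.coe_pow]
    rw [Q.ord_mul (pow_ne_zero _ hx0) (h0 j hj), Q.ord_pow, hx]
    linarith
  obtain ⟨c, hc⟩ := Q.exists_ord_lt_ord_sub hQ hf0 hg0 hgord
  have hxA : x ∈ Algebra.adjoin K {x} := Algebra.self_mem_adjoin_singleton K x
  have hcg : algebraMap K (ringInfty Q) c * g ∈
      Submodule.span (Algebra.adjoin K {x}) (η '' Set.Iio a) := by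
    have := Submodule.smul_mem _ (algebraMap K (Algebra.adjoin K {x}) c * ⟨x, hxA⟩ ^ d)
      (Submodule.subset_span (R := Algebra.adjoin K {x})
        (Set.mem_image_of_mem η (Set.mem_Iio.2 hj)))
    convert this using 1
    rw [hg, ← mul_assoc]
    rfl
  have hsub : f - algebraMap K (ringInfty Q) c * g ∈
      Submodule.span (Algebra.adjoin K {x}) (η '' Set.Iio a) := by
    have hmem : f - algebraMap K (ringInfty Q) c * g ∈ V :=
      V.sub_mem hf (V.mul_mem_left _ (V.mul_mem_left _ (hV j hj)))
    have hcoe : ((f - algebraMap K (ringInfty Q) c * g : ringInfty Q) : F) =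
      f - algebraMap K F c * g := rfl
    by_cases hz : ((f - algebraMap K (ringInfty Q) c * g : ringInfty Q) : F) = 0
    · rw [show f - algebraMap K (ringInfty Q) c * g = 0 from Subtype.ext hz]
      exact zero_mem _
    · refine ih _ ?_ hmem rfl
      have h1 := hB _ hmem hz
      have h2 := hc.resolve_left hz
      rw [← hcoe] at h2
      omega
  simpa using add_mem hsub hcg

/-- The elements of `L(∞Q)` that vanish to order at least `i` at all the places `P k`. -/
def vanishingIdeal {Q : Place K F} {n : ℕ} {P : Fin n → Place K F} (hPQ : ∀ k, P k ≠ Q)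
    (i : ℕ) : Ideal (ringInfty Q) where
  carrier := {f | ∀ k, (P k).val (f : F) ≤ WithZero.exp (-(i : ℤ))}
  zero_mem' := by simp
  add_mem' := fun hf hg k => (P k).val.map_add_le (hf k) (hg k)
  smul_mem' := fun c f hf k => by
    simpa using mul_le_mul' (Place.val_le_one_of_mem_ringInfty (hPQ k) c) (hf k)

/-- The polynomials all of whose monomials `c Z ^ t` satisfy `v_P(c) + t ≥ k`. -/
def weightSubmodule {P Q : Place K F} (hPQ : P ≠ Q) (k : ℤ) :
    Submodule (ringInfty Q) (ringInfty Q)[X] where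
  carrier := {p | ∀ t : ℕ, P.val (p.coeff t : F) ≤ WithZero.exp ((t : ℤ) - k)}
  zero_mem' := by simp
  add_mem' := fun hp hq t => by
    simpa using P.val.map_add_le (hp t) (hq t)
  smul_mem' := fun c p hp t => by
    simpa using mul_le_mul' (Place.val_le_one_of_mem_ringInfty hPQ c) (hp t)

/-! ### The weight filtration at one place, with Z of weight 1 -/

section weightSubmodule

variable {P Q : Place K F} (hPQ : P ≠ Q)

theorem mem_weightSubmodule {k : ℤ} {p : (ringInfty Q)[X]} :
    p ∈ weightSubmodule hPQ k ↔
      ∀ t : ℕ, P.val (p.coeff t : F) ≤ WithZero.exp ((t : ℤ) - k) := Iff.rfl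

theorem mem_weightSubmodule_zero (p : (ringInfty Q)[X]) : p ∈ weightSubmodule hPQ 0 := fun t =>
  (Place.val_le_one_of_mem_ringInfty hPQ _).trans (by
    rw [← WithZero.exp_zero, WithZero.exp_le_exp]
    omega)

theorem mul_mem_weightSubmodule {k l : ℤ} {p q : (ringInfty Q)[X]}
    (hp : p ∈ weightSubmodule hPQ k) (hq : q ∈ weightSubmodule hPQ l) :
    p * q ∈ weightSubmodule hPQ (k + l) := fun t => by
  rw [coeff_mul, AddSubmonoidClass.coe_finsetSum]
  refine P.val.map_sum_le fun s hs => ?_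
  rw [Finset.HasAntidiagonal.mem_antidiagonal] at hs
  rw [MulMemClass.coe_mul, map_mul]
  refine (mul_le_mul' (hp _) (hq _)).trans ?_
  rw [← WithZero.exp_add, WithZero.exp_le_exp]
  omega

theorem pow_mem_weightSubmodule {p : (ringInfty Q)[X]}
    (hp : p ∈ weightSubmodule hPQ 1) (s : ℕ) : p ^ s ∈ weightSubmodule hPQ s := by
  induction s with
  | zero => exact mem_weightSubmodule_zero hPQ _
  | succ s ih =>
    rw [pow_succ, Nat.cast_succ]
    exact mul_mem_weightSubmodule hPQ ih hp

theorem C_mem_weightSubmodule {k : ℤ} {c : ringInfty Q}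
    (hc : P.val (c : F) ≤ WithZero.exp (-k)) : C c ∈ weightSubmodule hPQ k := fun t => by
  rw [coeff_C]
  split_ifs with ht
  · simpa [ht] using hc
  · simp

theorem X_mem_weightSubmodule : (X : (ringInfty Q)[X]) ∈ weightSubmodule hPQ 1 := fun t => by
  rw [coeff_X]
  split_ifs with ht
  · simp [← ht]
  · simp

/-- As `g` vanishes at `P`, the polynomial `X + C g` still has weight 1, so substituting it for `X`
loses no weight in any monomial. -/
theorem comp_X_add_C_mem_weightSubmodule {k : ℤ} {g : ringInfty Q} (hg : P.val (g : F) < 1)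
    {p : (ringInfty Q)[X]} (hp : p ∈ weightSubmodule hPQ k) :
    p.comp (X + C g) ∈ weightSubmodule hPQ k := by
  -- The valuation is discrete: positive order means order at least 1.
  have hg' : P.val (g : F) ≤ WithZero.exp (-1) := by
    by_cases h0 : P.val (g : F) = 0
    · simp [h0]
    · rw [← WithZero.log_le_iff_le_exp h0]
      rw [← WithZero.exp_zero, ← WithZero.log_lt_iff_lt_exp h0] at hg
      omega
  rw [comp_eq_sum_left]
  refine Submodule.sum_mem _ fun s _ => ?_
  have h1 : C (p.coeff s) ∈ weightSubmodule hPQ (k - s) :=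
    C_mem_weightSubmodule hPQ (by simpa using hp s)
  have h2 := pow_mem_weightSubmodule hPQ
    (add_mem (X_mem_weightSubmodule hPQ) (C_mem_weightSubmodule hPQ hg')) s
  simpa using mul_mem_weightSubmodule hPQ h1 h2

/-- The two translates differ by the shift `h - r`, which vanishes at `P`, as does its inverse shift
`r - h`; weight is preserved both ways. -/
theorem hasMultiplicity_iff_comp_mem_weightSubmodule {r : K} {h : ringInfty Q}
    (hh : P.HasValue (h : F) r) (p : (ringInfty Q)[X]) (m : ℕ) :
    HasMultiplicity p P r m ↔ p.comp (X + C h) ∈ weightSubmodule hPQ m := by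
  have hval : P.val ((h - algebraMap K (ringInfty Q) r : ringInfty Q) : F) < 1 := hh
  have key : HasMultiplicity p P r m ↔
      p.comp (X + C (algebraMap K (ringInfty Q) r)) ∈ weightSubmodule hPQ m := by
    refine forall_congr' fun t => ?_
    rw [← neg_sub, ← P.eq_zero_or_le_ord_iff]
    simp only [sub_le_iff_le_add]
  rw [key]
  constructor
  · intro hp
    convert comp_X_add_C_mem_weightSubmodule hPQ hval hp using 1
    rw [comp_assoc]
    simp [add_assoc]
  · intro hp
    have hval' : P.val ((algebraMap K (ringInfty Q) r - h : ringInfty Q) : F) < 1 := by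
      rwa [← neg_sub, NegMemClass.coe_neg, Valuation.map_neg]
    convert comp_X_add_C_mem_weightSubmodule hPQ hval' hp using 1
    rw [comp_assoc]
    simp [add_assoc]

end weightSubmodule

/-- The module of interpolation polynomials, described by the expansion in powers of `Z - h`. -/
noncomputable def interpolationSubmodule {Q : Place K F} {n : ℕ} {P : Fin n → Place K F}
    (hPQ : ∀ k, P k ≠ Q) (h : ringInfty Q) (m ℓ : ℕ) :
    Submodule (ringInfty Q) (ringInfty Q)[X] :=
  (⨅ k, (weightSubmodule (hPQ k) m).comap (taylor h)) ⊓ degreeLE (ringInfty Q) ℓ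

theorem mem_interpolationSubmodule {Q : Place K F} {n : ℕ} {P : Fin n → Place K F}
    (hPQ : ∀ k, P k ≠ Q) {h : ringInfty Q} {m ℓ : ℕ} {p : (ringInfty Q)[X]} :
    p ∈ interpolationSubmodule hPQ h m ℓ ↔
      (∀ k, p.comp (X + C h) ∈ weightSubmodule (hPQ k) m) ∧ p.degree ≤ ℓ := by
  simp [interpolationSubmodule, mem_degreeLE, taylor_apply]

theorem coe_interpolationSubmodule {Q : Place K F} {n : ℕ} {P : Fin n → Place K F}
    (hPQ : ∀ k, P k ≠ Q) {r : Fin n → K} {h : ringInfty Q}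
    (hh : ∀ k, (P k).HasValue (h : F) (r k)) (m ℓ : ℕ) :
    (interpolationSubmodule hPQ h m ℓ : Set (ringInfty Q)[X]) =
      interpolationModule Q P r m ℓ := by
  ext p
  rw [SetLike.mem_coe, mem_interpolationSubmodule, interpolationModule, Set.mem_ofPred_eq]
  simp only [hasMultiplicity_iff_comp_mem_weightSubmodule (hPQ _) (hh _)]

/-! ### Expansion in powers of Z - h and assembly of the generators -/

theorem mul_C_mem_of_mem_span {R S : Type*} [CommRing R] [CommRing S] [Algebra R S]
    {s : Set S} {c : S} (hc : c ∈ Submodule.span R s) {N : Submodule R S[X]} {q : S[X]}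
    (hN : ∀ g ∈ s, q * C g ∈ N) : q * C c ∈ N := by
  induction hc using Submodule.span_induction with
  | mem g hg => exact hN g hg
  | zero => simp
  | add g g' _ _ hg hg' =>
    rw [C_add, mul_add]
    exact add_mem hg hg'
  | smul a g _ hg =>
    rw [← smul_C, mul_smul_comm]
    exact N.smul_mem a hg

/-- Taylor expansion at `h` with the tail divided by `(X - C h) ^ m`. The quotient stays unexpanded
so that it can be rewritten in powers of `X`, as the second family of generators requires. -/
theorem exists_eq_sum_add_mul_X_sub_C_pow {R : Type*} [CommRing R] (p : R[X])
    (h : R) {m ℓ : ℕ} (hmℓ : m ≤ ℓ) (hp : p.degree ≤ ℓ) :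
    ∃ q : R[X], q.natDegree ≤ ℓ - m ∧
      p = ∑ t ∈ Finset.range m, (X - C h) ^ t * C ((p.comp (X + C h)).coeff t) +
        q * (X - C h) ^ m := by
  refine ⟨∑ t ∈ Finset.range (ℓ + 1 - m), C ((p.comp (X + C h)).coeff (m + t)) * (X - C h) ^ t,
    natDegree_sum_le_of_forall_le _ _ fun t ht => ?_, ?_⟩
  · have := Finset.mem_range.1 ht
    have h1 : ((X - C h) ^ t).natDegree ≤ t * 1 :=
      natDegree_pow_le_of_le t (natDegree_X_sub_C_le h)
    exact (natDegree_C_mul_le _ _).trans (by omega)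
  · have hlt : (taylor h p).natDegree < m + (ℓ + 1 - m) := by
      have := natDegree_le_of_degree_le hp
      rw [natDegree_taylor]
      omega
    conv_lhs => rw [← sum_taylor_eq p h, sum_over_range' _ (by simp) _ hlt,
      Finset.sum_range_add]
    rw [Finset.sum_mul]
    congr 1 <;> refine Finset.sum_congr rfl fun t _ => ?_ <;> rw [taylor_apply] <;> ring

end

theorem mainTheorem4 {K F : Type*} [Field K] [Finite K] [Field F] [Algebra K F]
    (hF : IsAlgebraicFunctionField K F)
    (Q : Place K F) (hQ : Q.deg = 1)
    (n : ℕ) (P : Fin n → Place K F) (hP : ∀ i, (P i).deg = 1)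
    (hPinj : Function.Injective P) (hPQ : ∀ i, P i ≠ Q)
    (a₁ : ℕ) (ha₁ : 0 < a₁) (x₁ : ringInfty Q)
    (hx₁ : HasPoleDivisor (x₁ : F) (a₁ • Q.toDivisor))
    (r : Fin n → K) (h : ringInfty Q) (hh : ∀ i, (P i).HasValue (h : F) (r i))
    (m ℓ : ℕ) (hmℓ : m ≤ ℓ)
    (η : ℕ → ℕ → ringInfty Q)
    (hη : ∀ i ≤ m, ∀ j < a₁,
      IsMinimalPoleOrder (-(i • ∑ k, (P k).toDivisor)) Q a₁ j (η i j : F)) :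
    (Submodule.span (Algebra.adjoin K {x₁})
      ({p : (ringInfty Q)[X] | ∃ i ≤ m, ∃ j < a₁, p = (X - C h) ^ (m - i) * C (η i j)} ∪
       {p : (ringInfty Q)[X] | ∃ ℓ', m < ℓ' ∧ ℓ' ≤ ℓ ∧ ∃ j < a₁,
          p = X ^ (ℓ' - m) * (X - C h) ^ m * C (η 0 j)}) : Set (ringInfty Q)[X]) =
      interpolationModule Q P r m ℓ := by
  have hηV : ∀ i ≤ m, ∀ j < a₁, η i j ∈ vanishingIdeal hPQ i := fun i hi j hj =>
    (coe_mem_spaceInfty_neg_iff hPinj hPQ i _).1 (hη i hi j hj).1.1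
  have hx : Q.ord (x₁ : F) = -a₁ := by
    have := hx₁.2 Q
    simp only [Place.toDivisor, Finsupp.smul_apply, Finsupp.single_eq_same, nsmul_eq_mul,
      mul_one] at this
    omega
  have hspan : ∀ i ≤ m, ∀ f ∈ vanishingIdeal hPQ i,
      f ∈ Submodule.span (Algebra.adjoin K {x₁}) (η i '' Set.Iio a₁) := fun i hi f hf =>
    mem_span_of_minimal_pole_order hQ ha₁ hx (vanishingIdeal hPQ i) (η i) (hηV i hi)
      (fun j hj => (hη i hi j hj).1.2.1) (fun j hj => (hη i hi j hj).1.2.2)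
      (fun j hj g hg => (hη i hi j hj).2 g
        ((coe_mem_spaceInfty_neg_iff hPinj hPQ i g).2 hg)) hf
  rw [← coe_interpolationSubmodule hPQ hh]
  refine Set.Subset.antisymm ?_ ?_
  · change _ ≤ (interpolationSubmodule hPQ h m ℓ).restrictScalars (Algebra.adjoin K {x₁})
    rw [Submodule.span_le]
    rintro p (⟨i, hi, j, hj, rfl⟩ | ⟨l, hml, hl, j, hj, rfl⟩)
    · refine (mem_interpolationSubmodule hPQ).2 ⟨fun k => ?_, ?_⟩
      -- The shift turns `X - C h` into `X`; the weights `m - i` and `i` add up to `m`.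
      · have h1 := mul_mem_weightSubmodule (hPQ k)
          (pow_mem_weightSubmodule (hPQ k) (X_mem_weightSubmodule (hPQ k)) (m - i))
          (C_mem_weightSubmodule (hPQ k) (hηV i hi j hj k))
        rw [Nat.cast_sub hi, sub_add_cancel] at h1
        simpa using h1
      · refine degree_le_of_natDegree_le ((natDegree_mul_C_le _ _).trans ?_)
        rw [natDegree_pow, natDegree_X_sub_C]
        omega
    · refine (mem_interpolationSubmodule hPQ).2 ⟨fun k => ?_, ?_⟩
      · have h1 := mul_mem_weightSubmodule (hPQ k) (mul_mem_weightSubmodule (hPQ k)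
          (mem_weightSubmodule_zero (hPQ k) ((X + C h) ^ (l - m)))
          (pow_mem_weightSubmodule (hPQ k) (X_mem_weightSubmodule (hPQ k)) m))
          (mem_weightSubmodule_zero (hPQ k) (C (η 0 j)))
        simpa using h1
      · refine degree_le_of_natDegree_le ((natDegree_mul_C_le _ _).trans
          (natDegree_mul_le.trans ?_))
        rw [natDegree_pow, natDegree_pow, natDegree_X_sub_C, natDegree_X]
        omega
  · intro p hp
    obtain ⟨hw, hdeg⟩ := (mem_interpolationSubmodule hPQ).1 hp
    obtain ⟨q, hq, hpq⟩ := exists_eq_sum_add_mul_X_sub_C_pow p h hmℓ hdeg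
    rw [SetLike.mem_coe, hpq]
    refine add_mem (sum_mem fun t ht => ?_) ?_
    · have ht' := Finset.mem_range.1 ht
      refine mul_C_mem_of_mem_span (hspan (m - t) (by omega) _ fun k => ?_) ?_
      · refine (hw k t).trans_eq ?_
        rw [Nat.cast_sub ht'.le, neg_sub]
      · rintro _ ⟨j, hj, rfl⟩
        refine Submodule.subset_span (Or.inl ⟨m - t, by omega, j, hj, ?_⟩)
        rw [Nat.sub_sub_self ht'.le]
    -- The coefficients of `q` are unconstrained: they lie in the vanishing ideal of order 0, which
    -- is all of L(∞Q).
    · rw [q.as_sum_range_C_mul_X_pow, Finset.sum_mul]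
      refine sum_mem fun s hs => ?_
      rw [mul_assoc, mul_comm]
      refine mul_C_mem_of_mem_span (hspan 0 (Nat.zero_le _) _ fun k => ?_) ?_
      · simpa using Place.val_le_one_of_mem_ringInfty (hPQ k) _
      · rintro _ ⟨j, hj, rfl⟩
        -- The second family starts at `ℓ' = m + 1`; the term `s = 0` is the case `i = 0` of the
        -- first.
        rcases Nat.eq_zero_or_pos s with rfl | hs0
        · exact Submodule.subset_span (Or.inl ⟨0, Nat.zero_le _, j, hj, by simp⟩)
        · have := Finset.mem_range.1 hs
          refine Submodule.subset_span (Or.inr ⟨m + s, by omega, by omega, j, hj, ?_⟩)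
          rw [Nat.add_sub_cancel_left]
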